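/- Let $(\Omega,\mathcal F,\mu)$ be a complete $\sigma$-finite measure space, let $(\mathsf H_\omega)_{\omega\in\Omega}$ be a family of real Hilbert spaces, and let $\mathfrak G$ be a vector subspace of $\prod_{\omega\in\Omega}\mathsf H_\omega$ such that (a) for every $x\in\mathfrak G$ the function $\omega\mapsto\|x(\omega)\|_{\mathsf H_\omega}$ is $\mathcal F$-measurable; (b) every $x\in\prod_{\omega\in\Omega}\mathsf H_\omega$ such that $\omega\mapsto\langle x(\omega),y(\omega)\rangle_{\mathsf H_\omega}$ is $\mathcal F$-measurable for all $y\in\mathfrak G$ belongs to $\mathfrak G$; (c) there is a sequence $(e_n)_{n\in\mathbb N}$ in $\mathfrak G$ such that, for every $\omega\in\Omega$, the closed linear span of $\{e_n(\omega)\}_{n\in\mathbb N}$ is $\mathsf H_\omega$. Let $\mathcal H$ be the Hilbert direct integral of $(\mathsf H_\omega)_{\omega\in\Omega}$ relative to $\mathfrak G$, i.e., the Hilbert space of classes of $\mu$-a.e. equal $x\in\mathfrak G$ with $\int_\Omega\|x(\omega)\|_{\mathsf H_\omega}^2\,\mu(d\omega)<+\infty$, with scalar product $\langle x,y\rangle=\int_\Omega\langle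 x(\omega),y(\omega)\rangle_{\mathsf H_\omega}\,\mu(d\omega)$. For every $\omega\in\Omega$, let $\mathsf A_\omega\colon\mathsf H_\omega\to 2^{\mathsf H_\omega}$ be maximally monotone, and let $A\colon\mathcal H\to 2^{\mathcal H}$ be the direct integral of these operators, defined by $$Ax=\{x^*\in\mathcal H : x^*(\omega)\in\mathsf A_\omega(x(\omega))\text{ for $\mu$-a.e. }\omega\in\Omega\}.$$ For a real Hilbert space $K$, let $\Gamma_0(K)$ be the set of lower semicontinuous convex functions $f\colon K\to\,]-\infty,+\infty]$ that are not identically $+\infty$, let $\partial f(x)=\{x^*\in K : \langle y-x,x^*\rangle+f(x)\le f(y)\text{ for all }y\in K\}$ and, for a nonempty closed convex $C\subset K$, let $N_C(x)=\{x^*\in K : \langle y-x,x^*\rangle\le 0\text{ for all }y\in C\}$ if $x\in C$ and $N_C(x)=\varnothing$ otherwise. Then the following hold. (i) If there exists $f\in\Gamma_0(\mathcal H)$ such that $A=\partial f$, then for $\mu$-almost every $\omega\in\Omega$ there exists $\mathsf f_\omega\in\Gamma_0(\mathsf H_\omega)$ such that $\mathsf A_\omega=\partial\mathsf f_\omega$.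 (ii) If there exists a nonempty closed convex set $C\subset\mathcal H$ such that $A=N_C$, then for $\mu$-almost every $\omega\in\Omega$ there exists a nonempty closed convex set $\mathsf C_\omega\subset\mathsf H_\omega$ such that $\mathsf A_\omega=N_{\mathsf C_\omega}$. -/

import Mathlib

open MeasureTheory
open scoped ENNReal

noncomputable section

/-! ### Set-valued operators and convex functions on a real inner product space -/

section Convex

variable {E : Type*} [NormedAddCommGroup E] [InnerProductSpace ℝ E]

/-- A set-valued operator `A : E → 2^E` is monotone. -/
def MonotoneOperator (A : E → Set E) : Prop :=
  ∀ x y : E, ∀ u ∈ A x, ∀ v ∈ A y, 0 ≤ inner ℝ (x - y) (u - v)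

/-- `A` is maximally monotone: it is monotone and its graph is not properly contained in the
graph of another monotone operator. -/
def MaximallyMonotone (A : E → Set E) : Prop :=
  MonotoneOperator A ∧
    ∀ B : E → Set E, MonotoneOperator B → (∀ x, A x ⊆ B x) → B = A

/-- The class `Γ₀(E)` of lower semicontinuous convex functions `E → ]-∞, +∞]` that are not
identically `+∞`. -/
structure GammaZero (f : E → EReal) : Prop where
  ne_bot : ∀ x, f x ≠ ⊥
  proper : ∃ x, f x ≠ ⊤
  lowerSemicontinuous : LowerSemicontinuous f
  convex : ∀ x y : E, ∀ t : ℝ, 0 < t → t < 1 →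
    f (t • x + (1 - t) • y) ≤ (t : EReal) * f x + ((1 - t : ℝ) : EReal) * f y

/-- The subdifferential of `f`. -/
def subdiff (f : E → EReal) (x : E) : Set E :=
  {u | ∀ y : E, ((inner ℝ (y - x) u : ℝ) : EReal) + f x ≤ f y}

/-- The normal cone operator of `C`, with empty values outside of `C`. -/
def normalConeOp (C : Set E) (x : E) : Set E :=
  {u | x ∈ C ∧ ∀ y ∈ C, inner ℝ (y - x) u ≤ 0}

end Convex

/-! ### Measurable vector fields and Hilbert direct integrals -/

section DirectIntegral

variable {Ω : Type*} [MeasurableSpace Ω] {H : Ω → Type*}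
  [∀ ω, NormedAddCommGroup (H ω)] [∀ ω, InnerProductSpace ℝ (H ω)]

/-- A measurable vector field structure on the family `H`: the vector space `sections` of
measurable sections of the family. -/
structure MeasurableVectorField {Ω : Type*} [MeasurableSpace Ω] (H : Ω → Type*)
    [∀ ω, NormedAddCommGroup (H ω)] [∀ ω, InnerProductSpace ℝ (H ω)] where
  sections : Submodule ℝ (∀ ω, H ω)
  measurable_norm : ∀ x ∈ sections, Measurable fun ω => ‖x ω‖
  mem_of_measurable_inner : ∀ x : ∀ ω, H ω,
    (∀ y ∈ sections, Measurable fun ω => inner ℝ (x ω) (y ω)) → x ∈ sections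
  exists_total : ∃ e : ℕ → ∀ ω, H ω, (∀ n, e n ∈ sections) ∧
    ∀ ω, (Submodule.span ℝ (Set.range fun n => e n ω)).topologicalClosure = ⊤

namespace MeasurableVectorField

variable (G : MeasurableVectorField H) (μ : Measure Ω)

/-- The vector space of square-integrable measurable sections. -/
def sqIntegrable : Submodule ℝ (∀ ω, H ω) where
  carrier := {x | x ∈ G.sections ∧ ∫⁻ ω, ‖x ω‖ₑ ^ 2 ∂μ < ∞}
  zero_mem' := ⟨G.sections.zero_mem, by simp⟩
  add_mem' := by
    rintro x y ⟨hx, hx'⟩ ⟨hy, hy'⟩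
    refine ⟨G.sections.add_mem hx hy, ?_⟩
    have hmx : Measurable fun ω => ‖x ω‖ₑ ^ 2 := by
      have h := ((G.measurable_norm x hx).ennreal_ofReal).pow_const 2
      simpa only [ofReal_norm] using h
    calc ∫⁻ ω, ‖(x + y) ω‖ₑ ^ 2 ∂μ
        ≤ ∫⁻ ω, (2 * ‖x ω‖ₑ ^ 2 + 2 * ‖y ω‖ₑ ^ 2) ∂μ := by
          refine lintegral_mono fun ω => ?_
          have h1 : ‖(x + y) ω‖ₑ ≤ ‖x ω‖ₑ + ‖y ω‖ₑ := enorm_add_le _ _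
          have h2 : (‖x ω‖₊ + ‖y ω‖₊) ^ 2 ≤ 2 * ‖x ω‖₊ ^ 2 + 2 * ‖y ω‖₊ ^ 2 := by
            rw [← NNReal.coe_le_coe]
            push_cast
            nlinarith [sq_nonneg (‖x ω‖ - ‖y ω‖)]
          calc ‖(x + y) ω‖ₑ ^ 2 ≤ (‖x ω‖ₑ + ‖y ω‖ₑ) ^ 2 := by gcongr
            _ ≤ _ := by
              simp only [enorm_eq_nnnorm]
              exact_mod_cast h2
      _ = 2 * ∫⁻ ω, ‖x ω‖ₑ ^ 2 ∂μ + 2 * ∫⁻ ω, ‖y ω‖ₑ ^ 2 ∂μ := by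
          rw [lintegral_add_left (hmx.const_mul 2), lintegral_const_mul' _ _ (by simp),
            lintegral_const_mul' _ _ (by simp)]
      _ < ∞ := ENNReal.add_lt_top.2
          ⟨ENNReal.mul_lt_top (by simp) hx', ENNReal.mul_lt_top (by simp) hy'⟩
  smul_mem' := by
    rintro c x ⟨hx, hx'⟩
    refine ⟨G.sections.smul_mem c hx, ?_⟩
    have : ∀ ω, ‖(c • x) ω‖ₑ ^ 2 = ‖c‖ₑ ^ 2 * ‖x ω‖ₑ ^ 2 := fun ω => by
      rw [Pi.smul_apply, enorm_smul, mul_pow]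
    simp only [this]
    rw [lintegral_const_mul' _ _ (by simp)]
    exact ENNReal.mul_lt_top (by simp) hx'

/-- The subspace of square-integrable sections that vanish almost everywhere. -/
def aeZero : Submodule ℝ (G.sqIntegrable μ) where
  carrier := {x | ∀ᵐ ω ∂μ, x.1 ω = 0}
  zero_mem' := by simp
  add_mem' := by
    intro x y hx hy
    change ∀ᵐ ω ∂μ, (x + y).1 ω = 0
    filter_upwards [hx, hy] with ω h1 h2
    simp [h1, h2]
  smul_mem' := by
    intro c x hx
    change ∀ᵐ ω ∂μ, (c • x).1 ω = 0
    filter_upwards [hx] with ω h1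
    simp [h1]

/-- The Hilbert direct integral of the family `H` relative to `G`: the space of classes of almost
everywhere equal square-integrable measurable sections. -/
def DirectIntegral : Type _ := G.sqIntegrable μ ⧸ G.aeZero μ

namespace DirectIntegral

instance : AddCommGroup (G.DirectIntegral μ) :=
  inferInstanceAs (AddCommGroup (G.sqIntegrable μ ⧸ G.aeZero μ))

instance : Module ℝ (G.DirectIntegral μ) :=
  inferInstanceAs (Module ℝ (G.sqIntegrable μ ⧸ G.aeZero μ))

variable {G μ}

/-- The class of a square-integrable measurable section. -/
def mk : G.sqIntegrable μ →ₗ[ℝ] G.DirectIntegral μ := (G.aeZero μ).mkQ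

theorem mk_surjective : Function.Surjective (mk : G.sqIntegrable μ → G.DirectIntegral μ) :=
  (G.aeZero μ).mkQ_surjective

theorem ae_eq_of_sub_mem {x y : G.sqIntegrable μ} (h : x - y ∈ G.aeZero μ) :
    ∀ᵐ ω ∂μ, x.1 ω = y.1 ω := by
  have h' : ∀ᵐ ω ∂μ, (x - y).1 ω = 0 := h
  filter_upwards [h'] with ω hω
  exact sub_eq_zero.1 hω

theorem mk_eq_mk_iff {x y : G.sqIntegrable μ} :
    (mk x : G.DirectIntegral μ) = mk y ↔ ∀ᵐ ω ∂μ, x.1 ω = y.1 ω := by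
  constructor
  · intro h
    exact ae_eq_of_sub_mem ((Submodule.Quotient.eq (G.aeZero μ)).1 h)
  · intro h
    refine (Submodule.Quotient.eq (G.aeZero μ)).2 ?_
    change ∀ᵐ ω ∂μ, (x - y).1 ω = 0
    filter_upwards [h] with ω hω
    exact sub_eq_zero.2 hω

theorem measurable_inner {x y : ∀ ω, H ω} (hx : x ∈ G.sections) (hy : y ∈ G.sections) :
    Measurable fun ω => (inner ℝ (x ω) (y ω) : ℝ) := by
  have h : ∀ ω, (inner ℝ (x ω) (y ω) : ℝ) =
      (‖(x + y) ω‖ * ‖(x + y) ω‖ - ‖x ω‖ * ‖x ω‖ - ‖y ω‖ * ‖y ω‖) / 2 := fun ω =>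
    real_inner_eq_norm_add_mul_self_sub_norm_mul_self_sub_norm_mul_self_div_two _ _
  simp only [h]
  have h1 := G.measurable_norm x hx
  have h2 := G.measurable_norm y hy
  have h3 := G.measurable_norm _ (G.sections.add_mem hx hy)
  exact (((h3.mul h3).sub (h1.mul h1)).sub (h2.mul h2)).div_const 2

theorem integrable_norm_sq (x : G.sqIntegrable μ) : Integrable (fun ω => ‖x.1 ω‖ ^ 2) μ := by
  refine ⟨((G.measurable_norm x.1 x.2.1).pow_const 2).aestronglyMeasurable, ?_⟩
  refine lt_of_le_of_lt (le_of_eq ?_) x.2.2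
  refine lintegral_congr fun ω => ?_
  rw [enorm_pow, enorm_norm]

theorem integrable_inner (x y : G.sqIntegrable μ) :
    Integrable (fun ω => (inner ℝ (x.1 ω) (y.1 ω) : ℝ)) μ := by
  refine ((integrable_norm_sq x).add (integrable_norm_sq y)).mono'
    (measurable_inner x.2.1 y.2.1).aestronglyMeasurable (Filter.Eventually.of_forall fun ω => ?_)
  refine (norm_inner_le_norm (𝕜 := ℝ) _ _).trans ?_
  change ‖x.1 ω‖ * ‖y.1 ω‖ ≤ ‖x.1 ω‖ ^ 2 + ‖y.1 ω‖ ^ 2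
  nlinarith [sq_nonneg (‖x.1 ω‖ - ‖y.1 ω‖), sq_nonneg ‖x.1 ω‖, sq_nonneg ‖y.1 ω‖]

/-- The scalar product `∫ ⟪x(ω), y(ω)⟫ μ(dω)` on the direct integral. -/
def innerProd (x y : G.DirectIntegral μ) : ℝ :=
  Quotient.liftOn₂' x y (fun u v => ∫ ω, inner ℝ (u.1 ω) (v.1 ω) ∂μ) (by
    intro u v u' v' hu hv
    have hu' := ae_eq_of_sub_mem ((Submodule.quotientRel_def _).1 hu)
    have hv' := ae_eq_of_sub_mem ((Submodule.quotientRel_def _).1 hv)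
    refine integral_congr_ae ?_
    filter_upwards [hu', hv'] with ω h1 h2
    rw [h1, h2])

theorem innerProd_mk (u v : G.sqIntegrable μ) :
    innerProd (mk u) (mk v) = ∫ ω, inner ℝ (u.1 ω) (v.1 ω) ∂μ := rfl

/-- The scalar product is symmetric, bilinear and positive definite. -/
abbrev core : InnerProductSpace.Core ℝ (G.DirectIntegral μ) where
  inner := innerProd
  conj_inner_symm x y := by
    obtain ⟨u, rfl⟩ := mk_surjective x
    obtain ⟨v, rfl⟩ := mk_surjective y
    simp only [innerProd_mk, conj_trivial]
    exact integral_congr_ae (Filter.Eventually.of_forall fun ω => real_inner_comm _ _)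
  re_inner_nonneg x := by
    obtain ⟨u, rfl⟩ := mk_surjective x
    rw [innerProd_mk]
    exact integral_nonneg fun ω => real_inner_self_nonneg
  add_left x y z := by
    obtain ⟨u, rfl⟩ := mk_surjective x
    obtain ⟨v, rfl⟩ := mk_surjective y
    obtain ⟨w, rfl⟩ := mk_surjective z
    rw [← map_add]
    simp only [innerProd_mk]
    rw [← integral_add (integrable_inner u w) (integrable_inner v w)]
    exact integral_congr_ae (Filter.Eventually.of_forall fun ω => inner_add_left _ _ _)
  smul_left x y r := by
    obtain ⟨u, rfl⟩ := mk_surjective x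
    obtain ⟨v, rfl⟩ := mk_surjective y
    rw [← map_smul]
    simp only [innerProd_mk, conj_trivial]
    rw [← integral_const_mul]
    exact integral_congr_ae (Filter.Eventually.of_forall fun ω => real_inner_smul_left _ _ _)
  definite x hx := by
    obtain ⟨u, rfl⟩ := mk_surjective x
    have hx' : ∫ ω, inner ℝ (u.1 ω) (u.1 ω) ∂μ = 0 := hx
    rw [integral_eq_zero_iff_of_nonneg (fun ω => real_inner_self_nonneg)
      (integrable_inner u u)] at hx'
    rw [← map_zero (mk : G.sqIntegrable μ →ₗ[ℝ] G.DirectIntegral μ)]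
    refine mk_eq_mk_iff.2 ?_
    filter_upwards [hx'] with ω hω
    exact inner_self_eq_zero.1 hω

instance : NormedAddCommGroup (G.DirectIntegral μ) :=
  (core : InnerProductSpace.Core ℝ (G.DirectIntegral μ)).toNormedAddCommGroup

instance : InnerProductSpace ℝ (G.DirectIntegral μ) :=
  InnerProductSpace.ofCore (core : InnerProductSpace.Core ℝ (G.DirectIntegral μ)).toCore

theorem inner_mk (u v : G.sqIntegrable μ) :
    (inner ℝ (mk u : G.DirectIntegral μ) (mk v) : ℝ) = ∫ ω, inner ℝ (u.1 ω) (v.1 ω) ∂μ := rfl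

end DirectIntegral

/-- The Hilbert direct integral of the set-valued operators `A ω`: it maps the class of `u` to
the set of classes of those `v` such that `v ω ∈ A ω (u ω)` for almost every `ω`. -/
def directIntegralOp (A : ∀ ω, H ω → Set (H ω)) (x : G.DirectIntegral μ) :
    Set (G.DirectIntegral μ) :=
  {y | ∃ u v : G.sqIntegrable μ, DirectIntegral.mk u = x ∧ DirectIntegral.mk v = y ∧
    ∀ᵐ ω ∂μ, v.1 ω ∈ A ω (u.1 ω)}

/-- Membership in a value of the direct integral operator does not depend on representatives. -/
theorem mk_mem_directIntegralOp_iff (A : ∀ ω, H ω → Set (H ω)) (u v : G.sqIntegrable μ) :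
    DirectIntegral.mk v ∈ G.directIntegralOp μ A (DirectIntegral.mk u) ↔
      ∀ᵐ ω ∂μ, v.1 ω ∈ A ω (u.1 ω) := by
  constructor
  · rintro ⟨u', v', hu, hv, h⟩
    filter_upwards [DirectIntegral.mk_eq_mk_iff.1 hu, DirectIntegral.mk_eq_mk_iff.1 hv, h]
      with ω h1 h2 h3
    rwa [← h1, ← h2]
  · intro h
    exact ⟨u, v, rfl, rfl, h⟩

end MeasurableVectorField

end DirectIntegral

end

/-! Among maximally monotone operators, subdifferentials of functions in Γ₀ are those with a
cyclically monotone graph (Rockafellar), and normal cone operators are those with `⟪y - x, u⟫ ≤ 0`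
for all `u ∈ A x` and all `y` in the domain. Both are closed conditions on finitely many points of
the graph, so each need only be tested on a dense part of the graph of `A ω`, and a countable one
keeps the exceptional sets null.

Such a dense part comes from the resolvent. The direct integral space is complete, so `x - z ∈ A z`
is solvable in it: `z` is a proximal point of `f`, or the projection onto `C`. Taking for `x` a
countable family of sections with dense values in every fibre gives pairs `(z, x - z)` which, by
nonexpansiveness of the resolvents in the fibres, have values dense in the graph of `A ω` for almost
every `ω` (`exists_ae_graph_subset_closure`). No measurability of `ω ↦ A ω` is needed.

It remains to localize the integrated conditions. For (i), if a cyclic sum of values is positive on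
a set `s`, the sections are kept on `s` and all replaced by a single pair off `s`; cyclic
monotonicity of the direct integral then forces `s` to be null (`ae_cyclicallyMonotone`). For (ii),
the values of `N_C` are cones, so `n • u` stays in `A ω x` for all natural `n`, and monotonicity of
`A ω` as `n → ∞` gives the sign condition (`ae_inner_nonpos_of_eq_normalConeOp`). -/

noncomputable section

/-! ### Convex analysis in one Hilbert space: resolvents and characterizations by the graph. -/

section ConvexAnalysis

open Filter Topology

variable {E : Type*} [NormedAddCommGroup E] [InnerProductSpace ℝ E]

namespace GammaZero

variable {f : E → EReal}

theorem coe_toReal (hf : GammaZero f) {x : E} (hx : f x ≠ ⊤) : (((f x).toReal : ℝ) : EReal) = f x :=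
  EReal.coe_toReal hx (hf.ne_bot x)

theorem convex_toReal (hf : GammaZero f) {x y : E} (hx : f x ≠ ⊤) (hy : f y ≠ ⊤) {t : ℝ}
    (h0 : 0 < t) (h1 : t < 1) :
    f (t • x + (1 - t) • y) ≠ ⊤ ∧
      (f (t • x + (1 - t) • y)).toReal ≤ t * (f x).toReal + (1 - t) * (f y).toReal := by
  have h := hf.convex x y t h0 h1
  rw [← hf.coe_toReal hx, ← hf.coe_toReal hy, ← EReal.coe_mul, ← EReal.coe_mul,
    ← EReal.coe_add] at h
  have ht : f (t • x + (1 - t) • y) ≠ ⊤ := ne_top_of_le_ne_top (EReal.coe_ne_top _) h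
  refine ⟨ht, ?_⟩
  rwa [← hf.coe_toReal ht, EReal.coe_le_coe_iff] at h

/-- A function in `Γ₀(E)` decreases at most linearly. -/
theorem exists_linear_lower_bound (hf : GammaZero f) (x : E) :
    ∃ a b : ℝ, 0 ≤ b ∧ ∀ y, f y ≠ ⊤ → a - b * ‖y - x‖ ≤ (f y).toReal := by
  obtain ⟨p, hp⟩ := hf.proper
  have hlt : (((f p).toReal - 1 : ℝ) : EReal) < f p := by
    conv_rhs => rw [← hf.coe_toReal hp]
    exact EReal.coe_lt_coe_iff.2 (by linarith)
  obtain ⟨δ, hδ, hball⟩ : ∃ δ > 0, ∀ ⦃y⦄, dist y p < δ → (((f p).toReal - 1 : ℝ) : EReal) < f y :=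
    Metric.eventually_nhds_iff.1 (hf.lowerSemicontinuous p _ hlt)
  have key : ∀ y, f y ≠ ⊤ → (f p).toReal - 1 - 2 / δ * ‖y - p‖ ≤ (f y).toReal := by
    intro y hy
    by_cases hyp : dist y p < δ
    · have h := hball hyp
      rw [← hf.coe_toReal hy, EReal.coe_lt_coe_iff] at h
      have : 0 ≤ 2 / δ * ‖y - p‖ := by positivity
      linarith
    · rw [dist_eq_norm, not_lt] at hyp
      have hr : 0 < ‖y - p‖ := hδ.trans_le hyp
      -- This `t` puts the point of the segment from `p` to `y` at distance `δ / 2` from `p`, inside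
      -- the ball where `f > f p - 1`; convexity then extrapolates that bound linearly to `y`.
      set t : ℝ := δ / (2 * ‖y - p‖) with ht
      have ht0 : 0 < t := by positivity
      have ht1 : t < 1 := by
        rw [ht, div_lt_one (by positivity)]
        linarith
      have htr : t * ‖y - p‖ = δ / 2 := by
        rw [ht]
        field_simp
      obtain ⟨h1, h2⟩ := hf.convex_toReal hy hp ht0 ht1
      have hd : dist (t • y + (1 - t) • p) p < δ := by
        have : t • y + (1 - t) • p - p = t • (y - p) := by module
        rw [dist_eq_norm, this, norm_smul, Real.norm_of_nonneg ht0.le, htr]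
        linarith
      have h3 := hball hd
      rw [← hf.coe_toReal h1, EReal.coe_lt_coe_iff] at h3
      have h4 : 2 / δ * ‖y - p‖ * t = 1 := by
        rw [mul_assoc, mul_comm ‖y - p‖ t, htr]
        field_simp
      have h5 : ((f p).toReal - 2 / δ * ‖y - p‖) * t ≤ (f y).toReal * t := by
        rw [sub_mul, h4]
        linarith
      have h6 := le_of_mul_le_mul_right h5 ht0
      linarith
  refine ⟨(f p).toReal - 1 - 2 / δ * ‖x - p‖, 2 / δ, by positivity, fun y hy => ?_⟩
  have h1 : ‖y - p‖ ≤ ‖y - x‖ + ‖x - p‖ := norm_sub_le_norm_sub_add_norm_sub _ _ _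
  have h2 := mul_le_mul_of_nonneg_left h1 (show 0 ≤ 2 / δ by positivity)
  have h3 := key y hy
  linarith

/-- The proximal objective attains its minimum. -/
theorem exists_isMin_prox [CompleteSpace E] (hf : GammaZero f) (x : E) :
    ∃ z, f z ≠ ⊤ ∧ ∀ y, f y ≠ ⊤ →
      (f z).toReal + ‖z - x‖ ^ 2 / 2 ≤ (f y).toReal + ‖y - x‖ ^ 2 / 2 := by
  obtain ⟨a, b, -, hab⟩ := hf.exists_linear_lower_bound x
  set φ : E → ℝ := fun y => (f y).toReal + ‖y - x‖ ^ 2 / 2 with hφ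
  set s : Set ℝ := φ '' {y | f y ≠ ⊤} with hs
  have hne : s.Nonempty := Set.Nonempty.image _ hf.proper
  have hbdd : BddBelow s := by
    -- This is the minimum of `a - b * r + r ^ 2 / 2` over real `r`.
    refine ⟨a - b ^ 2 / 2, ?_⟩
    rintro _ ⟨y, hy, rfl⟩
    have := hab y hy
    simp only [hφ]
    nlinarith [sq_nonneg (‖y - x‖ - b)]
  have hm : ∀ y, f y ≠ ⊤ → sInf s ≤ φ y := fun y hy => csInf_le hbdd ⟨y, hy, rfl⟩
  have hseq : ∀ n : ℕ, ∃ y, f y ≠ ⊤ ∧ φ y < sInf s + 1 / ((n : ℝ) + 1) := by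
    intro n
    obtain ⟨_, ⟨y, hy, rfl⟩, hlt⟩ := Real.lt_sInf_add_pos hne (Nat.one_div_pos_of_nat (n := n) (α := ℝ))
    exact ⟨y, hy, hlt⟩
  choose u hu hlt using hseq
  have hcauchy : CauchySeq u := by
    -- By the parallelogram law, `φ` at the midpoint is at most the mean of `φ (u n)` and `φ (u m)`
    -- minus `‖u n - u m‖ ^ 2 / 8`, while it is at least the infimum; hence the factor 8.
    refine cauchySeq_of_le_tendsto_0 (fun n : ℕ => √(8 * (1 / ((n : ℝ) + 1)))) ?_ ?_
    · intro n m N hn hm'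
      refine Real.le_sqrt_of_sq_le ?_
      obtain ⟨h1, h2⟩ := hf.convex_toReal (hu n) (hu m) (t := 1 / 2) (by norm_num) (by norm_num)
      have h3 := hm _ h1
      have h4 : ‖(1 / 2 : ℝ) • u n + (1 - 1 / 2 : ℝ) • u m - x‖ ^ 2 =
          ‖u n - x‖ ^ 2 / 2 + ‖u m - x‖ ^ 2 / 2 - ‖u n - u m‖ ^ 2 / 4 := by
        have e1 : (1 / 2 : ℝ) • u n + (1 - 1 / 2 : ℝ) • u m - x =
            (1 / 2 : ℝ) • ((u n - x) + (u m - x)) := by module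
        have e2 : u n - u m = (u n - x) - (u m - x) := by abel
        have e3 := parallelogram_law_with_norm ℝ (u n - x) (u m - x)
        rw [e1, e2, norm_smul, mul_pow, Real.norm_of_nonneg (by norm_num)]
        nlinarith
      have h5 := Nat.one_div_le_one_div (α := ℝ) hn
      have h6 := Nat.one_div_le_one_div (α := ℝ) hm'
      have h7 := hlt n
      have h8 := hlt m
      simp only [hφ] at h3 h7 h8
      rw [h4] at h3
      rw [dist_eq_norm]
      linarith
    · have := (tendsto_one_div_add_atTop_nhds_zero_nat (𝕜 := ℝ)).const_mul 8
      simpa using this.sqrt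
  obtain ⟨z, hz⟩ := cauchySeq_tendsto_of_complete hcauchy
  have hfz : f z ≤ ((sInf s - ‖z - x‖ ^ 2 / 2 : ℝ) : EReal) := by
    by_contra! hcon
    obtain ⟨c, hc1, hc2⟩ := EReal.lt_iff_exists_real_btwn.1 hcon
    have hev : ∀ᶠ n in atTop, (c : EReal) < f (u n) :=
      hz.eventually (hf.lowerSemicontinuous z _ hc2)
    have hlim : Tendsto (fun n : ℕ => sInf s + 1 / ((n : ℝ) + 1) - ‖u n - x‖ ^ 2 / 2) atTop
        (𝓝 (sInf s + 0 - ‖z - x‖ ^ 2 / 2)) :=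
      (tendsto_one_div_add_atTop_nhds_zero_nat.const_add _).sub
        (((hz.sub_const x).norm.pow 2).div_const 2)
    have hle : c ≤ sInf s + 0 - ‖z - x‖ ^ 2 / 2 := by
      refine ge_of_tendsto hlim ?_
      filter_upwards [hev] with n hn
      rw [← hf.coe_toReal (hu n), EReal.coe_lt_coe_iff] at hn
      have := hlt n
      simp only [hφ] at this
      linarith
    rw [EReal.coe_lt_coe_iff] at hc1
    linarith
  have hz' : f z ≠ ⊤ := ne_top_of_le_ne_top (EReal.coe_ne_top _) hfz
  refine ⟨z, hz', fun y hy => ?_⟩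
  rw [← hf.coe_toReal hz', EReal.coe_le_coe_iff] at hfz
  have := hm y hy
  simp only [hφ] at this
  linarith

/-- The resolvent of the subdifferential of a function in `Γ₀(E)` has full domain. -/
theorem exists_sub_mem_subdiff [CompleteSpace E] (hf : GammaZero f) (x : E) :
    ∃ z, x - z ∈ subdiff f z := by
  obtain ⟨z, hz, hmin⟩ := hf.exists_isMin_prox x
  refine ⟨z, fun y => ?_⟩
  by_cases hy : f y = ⊤
  · rw [hy]
    exact le_top
  rw [← hf.coe_toReal hz, ← hf.coe_toReal hy, ← EReal.coe_add, EReal.coe_le_coe_iff]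
  -- First-order optimality: compare the minimizer `z` with `t • y + (1 - t) • z`, divide by `t`,
  -- and let `t` tend to 0.
  have key : ∀ t : ℝ, 0 < t → t < 1 →
      inner ℝ (y - z) (x - z) + (f z).toReal ≤ (f y).toReal + t * (‖y - z‖ ^ 2 / 2) := by
    intro t h0 h1
    obtain ⟨h2, h3⟩ := hf.convex_toReal hy hz h0 h1
    have h4 := hmin _ h2
    have h5 : ‖t • y + (1 - t) • z - x‖ ^ 2 =
        t ^ 2 * ‖y - z‖ ^ 2 - 2 * t * inner ℝ (y - z) (x - z) + ‖z - x‖ ^ 2 := by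
      have e1 : t • y + (1 - t) • z - x = t • (y - z) - (x - z) := by module
      rw [e1, norm_sub_sq_real, norm_smul, mul_pow, real_inner_smul_left, Real.norm_of_nonneg h0.le,
        norm_sub_rev z x]
      ring
    rw [h5] at h4
    refine le_of_mul_le_mul_left ?_ h0
    nlinarith
  have hlim : Tendsto (fun t : ℝ => (f y).toReal + t * (‖y - z‖ ^ 2 / 2)) (𝓝[>] 0)
      (𝓝 ((f y).toReal + 0 * (‖y - z‖ ^ 2 / 2))) :=
    ((tendsto_id.mul_const _).const_add _).mono_left nhdsWithin_le_nhds
  rw [zero_mul, add_zero] at hlim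
  refine ge_of_tendsto hlim ?_
  filter_upwards [Ioo_mem_nhdsGT (zero_lt_one' ℝ)] with t ht
  exact key t ht.1 ht.2

end GammaZero

theorem monotoneOperator_subdiff {f : E → EReal} (hf : GammaZero f) :
    MonotoneOperator (subdiff f) := by
  have fin : ∀ x u, u ∈ subdiff f x → f x ≠ ⊤ := by
    intro x u hu hx
    obtain ⟨p, hp⟩ := hf.proper
    have h := hu p
    rw [hx, EReal.coe_add_top, top_le_iff] at h
    exact hp h
  intro x y u hu v hv
  have hx := fin x u hu
  have hy := fin y v hv
  have h1 := hu y
  have h2 := hv x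
  rw [← hf.coe_toReal hx, ← hf.coe_toReal hy, ← EReal.coe_add, EReal.coe_le_coe_iff] at h1 h2
  have h3 : (inner ℝ (x - y) (u - v) : ℝ) = - inner ℝ (y - x) u - inner ℝ (x - y) v := by
    rw [inner_sub_right, ← neg_sub y x, inner_neg_left, inner_neg_left]
  linarith

theorem monotoneOperator_normalConeOp (C : Set E) : MonotoneOperator (normalConeOp C) := by
  intro x y u hu v hv
  have h1 := hu.2 y hv.1
  have h2 := hv.2 x hu.1
  have h3 : (inner ℝ (x - y) (u - v) : ℝ) = - inner ℝ (y - x) u - inner ℝ (x - y) v := by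
    rw [inner_sub_right, ← neg_sub y x, inner_neg_left, inner_neg_left]
  linarith

/-- The resolvent of the normal cone operator of a closed convex set has full domain. -/
theorem exists_sub_mem_normalConeOp [CompleteSpace E] {C : Set E} (hne : C.Nonempty)
    (hcl : IsClosed C) (hcv : Convex ℝ C) (x : E) : ∃ z, x - z ∈ normalConeOp C z := by
  obtain ⟨z, hz, hmin⟩ := exists_norm_eq_iInf_of_complete_convex hne hcl.isComplete hcv x
  refine ⟨z, hz, fun y hy => ?_⟩
  rw [real_inner_comm]
  exact (norm_eq_iInf_iff_real_inner_le_zero hcv hz).1 hmin y hy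

/-- An empty graph is not maximal: the constant operator `{0}` is monotone and extends it. -/
theorem MaximallyMonotone.exists_mem {A : E → Set E} (hA : MaximallyMonotone A) :
    ∃ x u, u ∈ A x := by
  by_contra! h
  have hB : (fun _ => {0} : E → Set E) = A := by
    refine hA.2 _ ?_ fun x u hu => (h x u hu).elim
    rintro x y u rfl v rfl
    simp
  exact h 0 0 (hB ▸ rfl)

/-! ### Cyclic monotonicity and Rockafellar's construction. -/

/-- The sum `⟪p₁ - p₀, u₀⟫ + ⟪p₂ - p₁, u₁⟫ + ⋯ + ⟪x - pₙ, uₙ⟫` along a chain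
`(p₀, u₀), (p₁, u₁), …, (pₙ, uₙ)`, listed from the last pair to the first one. -/
def chainSum (a : E × E) : List (E × E) → E → ℝ
  | [], x => inner ℝ (x - a.1) a.2
  | p :: l, x => chainSum a l p.1 + inner ℝ (x - p.1) p.2

/-- A set of pairs is cyclically monotone. -/
def CyclicallyMonotone (S : Set (E × E)) : Prop :=
  ∀ a ∈ S, ∀ l : List (E × E), (∀ p ∈ l, p ∈ S) → chainSum a l a.1 ≤ 0

theorem continuous_chainSum (a : E × E) (l : List (E × E)) : Continuous (chainSum a l) := by
  cases l with
  | nil =>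
    change Continuous fun x => (inner ℝ (x - a.1) a.2 : ℝ)
    fun_prop
  | cons p l =>
    change Continuous fun x => chainSum a l p.1 + (inner ℝ (x - p.1) p.2 : ℝ)
    fun_prop

/-- Each chain sum is affine in its endpoint, which makes a supremum of chain sums convex. -/
theorem chainSum_combination (a : E × E) (l : List (E × E)) (x y : E) (t : ℝ) :
    chainSum a l (t • x + (1 - t) • y) = t * chainSum a l x + (1 - t) * chainSum a l y := by
  have h : ∀ p u : E, (inner ℝ (t • x + (1 - t) • y - p) u : ℝ) =
      t * inner ℝ (x - p) u + (1 - t) * inner ℝ (y - p) u := by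
    intro p u
    rw [← real_inner_smul_left, ← real_inner_smul_left, ← inner_add_left]
    congr 1
    module
  cases l with
  | nil => exact h _ _
  | cons p l =>
    simp only [chainSum, h]
    ring

theorem chainSum_of_fst_eq {a : E × E} {l : List (E × E)} (h : ∀ p ∈ l, p.1 = a.1) :
    chainSum a l a.1 = 0 := by
  induction l with
  | nil => simp [chainSum]
  | cons p l ih =>
    have hp : p.1 = a.1 := h p (by simp)
    simp only [chainSum, hp]
    rw [ih fun q hq => h q (by simp [hq])]
    simp

theorem tendsto_chainSum {ι : Type*} {φ : Filter ι} {F : ι → E × E → E × E} {a : E × E}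
    {l : List (E × E)} (ha : Tendsto (fun i => F i a) φ (𝓝 a))
    (hl : ∀ p ∈ l, Tendsto (fun i => F i p) φ (𝓝 p)) {x : ι → E} {y : E}
    (hx : Tendsto x φ (𝓝 y)) :
    Tendsto (fun i => chainSum (F i a) (l.map (F i)) (x i)) φ (𝓝 (chainSum a l y)) := by
  have fst : ∀ {p}, Tendsto (fun i => F i p) φ (𝓝 p) → Tendsto (fun i => (F i p).1) φ (𝓝 p.1) :=
    fun h => (continuous_fst.tendsto _).comp h
  have snd : ∀ {p}, Tendsto (fun i => F i p) φ (𝓝 p) → Tendsto (fun i => (F i p).2) φ (𝓝 p.2) :=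
    fun h => (continuous_snd.tendsto _).comp h
  induction l generalizing x y with
  | nil => exact (hx.sub (fst ha)).inner (snd ha)
  | cons p l ih =>
    have hp := hl p (by simp)
    exact (ih (fun q hq => hl q (by simp [hq])) (fst hp)).add ((hx.sub (fst hp)).inner (snd hp))

/-- A chain sum depends continuously on its pairs. The approximating sequence is attached to the
point rather than to its position in the list, so the approximating chains are still closed cycles.
-/
theorem CyclicallyMonotone.of_subset_closure {S T : Set (E × E)} (hS : CyclicallyMonotone S)
    (hT : T ⊆ closure S) : CyclicallyMonotone T := by
  intro a ha l hl
  have hex : ∀ p : E × E, ∃ r : ℕ → E × E, p ∈ T → (∀ n, r n ∈ S) ∧ Tendsto r atTop (𝓝 p) := by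
    intro p
    by_cases hp : p ∈ T
    · obtain ⟨r, hr⟩ := mem_closure_iff_seq_limit.1 (hT hp)
      exact ⟨r, fun _ => hr⟩
    · exact ⟨fun _ => p, fun h => (hp h).elim⟩
  choose r hr using hex
  have hlim := tendsto_chainSum (F := fun n p => r p n) (hr a ha).2
    (fun p hp => (hr p (hl p hp)).2) ((continuous_fst.tendsto _).comp (hr a ha).2)
  refine le_of_tendsto hlim (Eventually.of_forall fun n => ?_)
  refine hS _ ((hr a ha).1 n) _ fun p hp => ?_
  obtain ⟨q, hq, rfl⟩ := List.mem_map.1 hp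
  exact (hr q (hl q hq)).1 n

/-- Adding the subgradient inequalities along the chain telescopes the values of `f`. -/
theorem chainSum_add_le {f : E → EReal} {a : E × E} (ha : a.2 ∈ subdiff f a.1)
    {l : List (E × E)} (hl : ∀ p ∈ l, p.2 ∈ subdiff f p.1) (x : E) :
    ((chainSum a l x : ℝ) : EReal) + f a.1 ≤ f x := by
  induction l generalizing x with
  | nil => exact ha x
  | cons p l ih =>
    have h1 := ih (fun q hq => hl q (by simp [hq])) p.1
    have h2 := hl p (by simp) x
    calc ((chainSum a (p :: l) x : ℝ) : EReal) + f a.1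
        = ((inner ℝ (x - p.1) p.2 : ℝ) : EReal) + (((chainSum a l p.1 : ℝ) : EReal) + f a.1) := by
          rw [← add_assoc, ← EReal.coe_add, add_comm (inner ℝ _ _ : ℝ)]
          rfl
      _ ≤ ((inner ℝ (x - p.1) p.2 : ℝ) : EReal) + f p.1 := by gcongr
      _ ≤ f x := h2

theorem cyclicallyMonotone_subdiff {f : E → EReal} (hf : GammaZero f) :
    CyclicallyMonotone {p : E × E | p.2 ∈ subdiff f p.1} := by
  intro a ha l hl
  have hfin : f a.1 ≠ ⊤ := by
    intro h
    obtain ⟨p, hp⟩ := hf.proper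
    have h' := ha p
    rw [h, EReal.coe_add_top, top_le_iff] at h'
    exact hp h'
  have h := chainSum_add_le ha hl a.1
  rw [← hf.coe_toReal hfin, ← EReal.coe_add, EReal.coe_le_coe_iff] at h
  linarith

/-- Rockafellar's theorem: a maximally monotone operator with a cyclically monotone graph is the
subdifferential of a function in `Γ₀(E)`. -/
theorem MaximallyMonotone.exists_eq_subdiff {A : E → Set E} (hA : MaximallyMonotone A)
    (hc : CyclicallyMonotone {p : E × E | p.2 ∈ A p.1}) :
    ∃ g : E → EReal, GammaZero g ∧ A = subdiff g := by
  obtain ⟨x₀, u₀, h₀⟩ := hA.exists_mem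
  set a : E × E := (x₀, u₀) with ha
  -- Rockafellar's antiderivative. The empty list is allowed, which keeps `g` above `⊥`; cyclic
  -- monotonicity gives `g x₀ ≤ 0`.
  set g : E → EReal := fun x =>
    ⨆ l : {l : List (E × E) // ∀ p ∈ l, p.2 ∈ A p.1}, ((chainSum a l.1 x : ℝ) : EReal) with hg
  have hle : ∀ (l : List (E × E)) (_ : ∀ p ∈ l, p.2 ∈ A p.1) (x : E),
      ((chainSum a l x : ℝ) : EReal) ≤ g x := fun l hl x =>
    le_iSup (fun l : {l : List (E × E) // ∀ p ∈ l, p.2 ∈ A p.1} =>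
      ((chainSum a l.1 x : ℝ) : EReal)) ⟨l, hl⟩
  have hΓ : GammaZero g := by
    refine ⟨fun x h => ?_, ⟨x₀, ?_⟩, ?_, ?_⟩
    · have h1 := hle [] (by simp) x
      rw [h, le_bot_iff] at h1
      exact EReal.coe_ne_bot _ h1
    · refine ne_top_of_le_ne_top (EReal.coe_ne_top 0) (iSup_le fun l => ?_)
      exact EReal.coe_le_coe_iff.2 (hc a h₀ l.1 l.2)
    · exact lowerSemicontinuous_iSup fun l =>
        (continuous_coe_real_ereal.comp (continuous_chainSum a l.1)).lowerSemicontinuous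
    · intro x y t h0 h1
      refine iSup_le fun l => ?_
      rw [chainSum_combination, EReal.coe_add, EReal.coe_mul, EReal.coe_mul]
      have ht0 : (0 : EReal) ≤ (t : EReal) := EReal.coe_nonneg.2 h0.le
      have ht1 : (0 : EReal) ≤ ((1 - t : ℝ) : EReal) := EReal.coe_nonneg.2 (by linarith)
      exact add_le_add (mul_le_mul_of_nonneg_left (hle _ l.2 x) ht0)
        (mul_le_mul_of_nonneg_left (hle _ l.2 y) ht1)
  -- By maximality it suffices that the graph of `A` lies in that of `subdiff g`. Extending a chain
  -- that ends at `x` by the pair `(x, u)` adds `⟪y - x, u⟫`, and the longer chain also competes in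
  -- the supremum defining `g y`.
  refine ⟨g, hΓ, (hA.2 _ (monotoneOperator_subdiff hΓ) fun x u hu y => ?_).symm⟩
  rw [add_comm, ← EReal.le_sub_iff_add_le (Or.inl (EReal.coe_ne_bot _))
    (Or.inl (EReal.coe_ne_top _))]
  refine iSup_le fun l => ?_
  rw [EReal.le_sub_iff_add_le (Or.inl (EReal.coe_ne_bot _)) (Or.inl (EReal.coe_ne_top _)),
    ← EReal.coe_add]
  refine hle ((x, u) :: l.1) ?_ y
  simpa [hu] using l.2

/-- A maximally monotone operator that is orthogonal to the chords of its domain is the normal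
cone operator of the closed convex hull of its domain. -/
theorem MaximallyMonotone.exists_eq_normalConeOp {A : E → Set E} (hA : MaximallyMonotone A)
    (h : ∀ x y, ∀ u ∈ A x, ∀ v ∈ A y, inner ℝ (y - x) u ≤ 0) :
    ∃ D : Set E, D.Nonempty ∧ IsClosed D ∧ Convex ℝ D ∧ A = normalConeOp D := by
  obtain ⟨x₀, u₀, h₀⟩ := hA.exists_mem
  have hsub : {x | (A x).Nonempty} ⊆ closedConvexHull ℝ {x | (A x).Nonempty} :=
    subset_closedConvexHull
  refine ⟨closedConvexHull ℝ {x | (A x).Nonempty}, ⟨x₀, hsub ⟨u₀, h₀⟩⟩,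
    isClosed_closedConvexHull, convex_closedConvexHull, ?_⟩
  refine (hA.2 _ (monotoneOperator_normalConeOp _) fun x u hu => ⟨hsub ⟨u, hu⟩, ?_⟩).symm
  -- For fixed `(x, u)` the condition on `y` defines a closed half-space, so it passes from the
  -- domain to its closed convex hull.
  have hmin : closedConvexHull ℝ {x | (A x).Nonempty} ⊆
      {y | inner ℝ u y ≤ inner ℝ u x} := by
    refine closedConvexHull_min ?_ ?_ ?_
    · rintro y ⟨v, hv⟩
      have := h x y u hu v hv
      rw [real_inner_comm, inner_sub_right] at this
      simpa using this
    · exact convex_halfSpace_le (innerₗ E u).isLinear _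
    · exact isClosed_le (by fun_prop) continuous_const
  intro y hy
  have : inner ℝ u y ≤ inner ℝ u x := hmin hy
  rw [real_inner_comm, inner_sub_right]
  linarith

/-- If the points `z k` are values of the resolvent of a monotone operator at a dense family, then
the pairs `(z k, x k - z k)` are dense in its graph. -/
theorem MonotoneOperator.graph_subset_closure {ι : Type*} {A : E → Set E}
    (hA : MonotoneOperator A) {x z : ι → E} (hx : DenseRange x)
    (hz : ∀ k, x k - z k ∈ A (z k)) :
    {p : E × E | p.2 ∈ A p.1} ⊆ closure (Set.range fun k => (z k, x k - z k)) := by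
  rintro ⟨p, q⟩ hpq
  refine Metric.mem_closure_range_iff.2 fun ε hε => ?_
  -- A pair `(p, q)` of the graph is recovered from `p + q`, since `p` is the resolvent there. The
  -- second component may move twice as far as `p + q`, hence `ε / 2`.
  obtain ⟨k, hk⟩ := hx.exists_dist_lt (p + q) (half_pos hε)
  refine ⟨k, ?_⟩
  have h1 : ‖p - z k‖ ≤ ‖p + q - x k‖ := by
    have hm := hA p (z k) q hpq _ (hz k)
    have h2 : q - (x k - z k) = (p + q - x k) - (p - z k) := by abel
    rw [h2, inner_sub_right, real_inner_self_eq_norm_sq] at hm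
    have h3 := real_inner_le_norm (p - z k) (p + q - x k)
    by_contra! hlt
    nlinarith [norm_nonneg (p + q - x k)]
  have h2 : ‖q - (x k - z k)‖ ≤ ‖p + q - x k‖ + ‖p - z k‖ := by
    have h2 : q - (x k - z k) = (p + q - x k) - (p - z k) := by abel
    rw [h2]
    exact norm_sub_le _ _
  rw [dist_eq_norm] at hk
  rw [Prod.dist_eq, max_lt_iff, dist_eq_norm, dist_eq_norm]
  constructor <;> dsimp only <;> linarith

end ConvexAnalysis

/-! ### Gluing of sections and rational combinations. -/

section Sections

variable {Ω : Type*} {H : Ω → Type*}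

namespace MeasurableVectorField

open Classical in
/-- The section that agrees with `x` on `s` and with `y` outside of `s`. -/
def glue (s : Set Ω) (x y : ∀ ω, H ω) : ∀ ω, H ω := fun ω => if ω ∈ s then x ω else y ω

theorem glue_of_mem {s : Set Ω} {x y : ∀ ω, H ω} {ω : Ω} (h : ω ∈ s) : glue s x y ω = x ω :=
  if_pos h

theorem glue_of_notMem {s : Set Ω} {x y : ∀ ω, H ω} {ω : Ω} (h : ω ∉ s) : glue s x y ω = y ω :=
  if_neg h

variable [∀ ω, NormedAddCommGroup (H ω)] [∀ ω, InnerProductSpace ℝ (H ω)]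

/-- The linear combination of the sections `e n` whose rational coefficients are listed in `l`. -/
def ratCombination (e : ℕ → ∀ ω, H ω) (l : List (ℚ × ℕ)) : ∀ ω, H ω :=
  (l.map fun c => (c.1 : ℝ) • e c.2).sum

theorem ratCombination_append (e : ℕ → ∀ ω, H ω) (l l' : List (ℚ × ℕ)) :
    ratCombination e (l ++ l') = ratCombination e l + ratCombination e l' := by
  simp [ratCombination]

theorem ratCombination_smul (e : ℕ → ∀ ω, H ω) (q : ℚ) (l : List (ℚ × ℕ)) :
    ratCombination e (l.map fun c => (q * c.1, c.2)) = (q : ℝ) • ratCombination e l := by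
  induction l with
  | nil => simp [ratCombination]
  | cons c l ih =>
    simp only [ratCombination, List.map_cons, List.sum_cons, smul_add] at ih ⊢
    rw [ih, smul_smul]
    push_cast
    rfl

/-- The closure of the rational combinations is stable under sums and, by density of the rationals,
under real scaling; so it contains the span. -/
theorem denseRange_ratCombination {e : ℕ → ∀ ω, H ω} {ω : Ω}
    (he : (Submodule.span ℝ (Set.range fun n => e n ω)).topologicalClosure = ⊤) :
    DenseRange fun l => ratCombination e l ω := by
  set T : Set (H ω) := closure (Set.range fun l => ratCombination e l ω) with hT
  have hadd : ∀ v ∈ T, ∀ w ∈ T, v + w ∈ T := fun v hv w hw =>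
    map_mem_closure₂ continuous_add hv hw (by
      rintro _ ⟨l, rfl⟩ _ ⟨l', rfl⟩
      exact ⟨l ++ l', by simp [ratCombination_append]⟩)
  have hsmul : ∀ c : ℝ, ∀ v ∈ T, c • v ∈ T := fun c v hv =>
    map_mem_closure₂ continuous_smul (Rat.denseRange_cast (𝕜 := ℝ) c) hv (by
      rintro _ ⟨q, rfl⟩ _ ⟨l, rfl⟩
      exact ⟨l.map fun c => (q * c.1, c.2), by simp [ratCombination_smul]⟩)
  have hspan : (Submodule.span ℝ (Set.range fun n => e n ω) : Set (H ω)) ⊆ T := by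
    intro v hv
    induction hv using Submodule.span_induction with
    | mem v hv =>
      obtain ⟨n, rfl⟩ := hv
      exact subset_closure ⟨[(1, n)], by simp [ratCombination]⟩
    | zero => exact subset_closure ⟨[], by simp [ratCombination]⟩
    | add v w _ _ hv hw => exact hadd v hv w hw
    | smul c v _ hv => exact hsmul c v hv
  intro v
  have hv : v ∈ (Submodule.span ℝ (Set.range fun n => e n ω)).topologicalClosure := by
    rw [he]
    trivial
  exact closure_minimal hspan isClosed_closure hv

end MeasurableVectorField

end Sections

/-! ### Completeness of the direct integral and a countable family with dense values. -/

section DirectIntegralSpace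

open Filter Topology

variable {Ω : Type*} [MeasurableSpace Ω] {H : Ω → Type*}
  [∀ ω, NormedAddCommGroup (H ω)] [∀ ω, InnerProductSpace ℝ (H ω)]

namespace MeasurableVectorField

variable {G : MeasurableVectorField H}

theorem glue_mem_sections {s : Set Ω} (hs : MeasurableSet s) {x y : ∀ ω, H ω}
    (hx : x ∈ G.sections) (hy : y ∈ G.sections) : glue s x y ∈ G.sections := by
  classical
  refine G.mem_of_measurable_inner _ fun w hw => ?_
  convert (DirectIntegral.measurable_inner hx hw).piecewise hs
    (DirectIntegral.measurable_inner hy hw) using 2 with ω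
  by_cases h : ω ∈ s
  · rw [glue_of_mem h, Set.piecewise_eq_of_mem _ _ _ h]
  · rw [glue_of_notMem h, Set.piecewise_eq_of_notMem _ _ _ h]

theorem mem_sections_of_tendsto {u : ℕ → ∀ ω, H ω} (hu : ∀ n, u n ∈ G.sections)
    {x : ∀ ω, H ω} (h : ∀ ω, Tendsto (fun n => u n ω) atTop (𝓝 (x ω))) : x ∈ G.sections := by
  refine G.mem_of_measurable_inner _ fun w hw => ?_
  refine measurable_of_tendsto_metrizable
    (fun n => DirectIntegral.measurable_inner (hu n) hw) (tendsto_pi_nhds.2 fun ω => ?_)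
  exact (h ω).inner tendsto_const_nhds

theorem measurable_enorm_sq {x : ∀ ω, H ω} (hx : x ∈ G.sections) :
    Measurable fun ω => ‖x ω‖ₑ ^ 2 := by
  have h := ((G.measurable_norm x hx).ennreal_ofReal).pow_const 2
  simpa only [ofReal_norm] using h

variable {μ : Measure Ω}

theorem glue_mem_sqIntegrable {s : Set Ω} (hs : MeasurableSet s) {x y : ∀ ω, H ω}
    (hx : x ∈ G.sqIntegrable μ) (hy : y ∈ G.sqIntegrable μ) :
    glue s x y ∈ G.sqIntegrable μ := by
  refine ⟨glue_mem_sections hs hx.1 hy.1, ?_⟩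
  refine lt_of_le_of_lt (lintegral_mono fun ω => ?_)
    ((lintegral_add_left (measurable_enorm_sq hx.1) _).trans_lt (ENNReal.add_lt_top.2 ⟨hx.2, hy.2⟩))
  by_cases h : ω ∈ s
  · simp [glue_of_mem h]
  · simp [glue_of_notMem h]

namespace DirectIntegral

theorem lintegral_enorm_sq (u : G.sqIntegrable μ) :
    ∫⁻ ω, ‖u.1 ω‖ₑ ^ 2 ∂μ = ENNReal.ofReal (‖(mk u : G.DirectIntegral μ)‖ ^ 2) := by
  rw [← real_inner_self_eq_norm_sq, inner_mk,
    ofReal_integral_eq_lintegral_ofReal (integrable_inner u u)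
      (Eventually.of_forall fun ω => real_inner_self_nonneg)]
  refine lintegral_congr fun ω => ?_
  rw [real_inner_self_eq_norm_sq, ENNReal.ofReal_pow (norm_nonneg _), ofReal_norm]

/-- The weights `2 ^ n` still leave the squared increments with a summable integral, so the weighted
squares are summable almost everywhere. The increments are then summable because `r ≤ 2 ^ n * r ^ 2
+ (1 / 2) ^ n`. -/
theorem ae_cauchySeq {u : ℕ → G.sqIntegrable μ}
    (h : ∀ n, ‖(mk (u (n + 1)) : G.DirectIntegral μ) - mk (u n)‖ ≤ (1 / 2) ^ n) :
    ∀ᵐ ω ∂μ, CauchySeq fun n => (u n).1 ω := by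
  set d : ℕ → Ω → ℝ≥0∞ := fun n ω => 2 ^ n * ‖(u (n + 1) - u n).1 ω‖ₑ ^ 2 with hd
  have hmeas : ∀ n, Measurable (d n) := fun n =>
    (measurable_enorm_sq (u (n + 1) - u n).2.1).const_mul _
  have hint : ∀ n, ∫⁻ ω, d n ω ∂μ ≤ ENNReal.ofReal ((1 / 2) ^ n) := by
    intro n
    simp only [hd]
    rw [lintegral_const_mul' _ _ (by simp), lintegral_enorm_sq, map_sub]
    have h2 : (2 : ℝ≥0∞) ^ n = ENNReal.ofReal (2 ^ n) := by
      rw [ENNReal.ofReal_pow (by norm_num)]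
      simp
    rw [h2, ← ENNReal.ofReal_mul (by positivity)]
    refine ENNReal.ofReal_le_ofReal ?_
    calc (2 : ℝ) ^ n * ‖(mk (u (n + 1)) : G.DirectIntegral μ) - mk (u n)‖ ^ 2
        ≤ 2 ^ n * ((1 / 2) ^ n) ^ 2 := by
          gcongr
          exact h n
      _ = (1 / 2) ^ n := by
          rw [sq, ← mul_assoc, ← mul_pow]
          norm_num
  have hfin : ∫⁻ ω, ∑' n, d n ω ∂μ ≠ ∞ := by
    rw [lintegral_tsum fun n => (hmeas n).aemeasurable]
    refine ne_top_of_le_ne_top ?_ (ENNReal.tsum_le_tsum hint)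
    rw [← ENNReal.ofReal_tsum_of_nonneg (fun n => by positivity) summable_geometric_two]
    exact ENNReal.ofReal_ne_top
  filter_upwards [ae_lt_top (Measurable.tsum hmeas) hfin] with ω hω
  have hsum : Summable fun n => (2 : ℝ) ^ n * ‖(u (n + 1) - u n).1 ω‖ ^ 2 := by
    have := ENNReal.summable_toReal hω.ne
    simpa [hd] using this
  refine cauchySeq_of_summable_dist
    (Summable.of_nonneg_of_le (fun n => dist_nonneg) (fun n => ?_)
      (hsum.add summable_geometric_two))
  rw [dist_comm, dist_eq_norm]
  change ‖(u (n + 1) - u n).1 ω‖ ≤ _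
  set r := ‖(u (n + 1) - u n).1 ω‖
  have e : (2 : ℝ) ^ n * (1 / 2) ^ n = 1 := by
    rw [← mul_pow]
    norm_num
  have h1 : (0 : ℝ) < 2 ^ n := by positivity
  have h2 : (0 : ℝ) < (1 / 2) ^ n := by positivity
  nlinarith [mul_nonneg h2.le (sq_nonneg ((2 : ℝ) ^ n * r - 1)), sq_nonneg r,
    norm_nonneg ((u (n + 1) - u n).1 ω)]

theorem norm_mk_le_of_lintegral_le {u : G.sqIntegrable μ} {r : ℝ} (hr : 0 ≤ r)
    (h : ∫⁻ ω, ‖u.1 ω‖ₑ ^ 2 ∂μ ≤ ENNReal.ofReal (r ^ 2)) :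
    ‖(mk u : G.DirectIntegral μ)‖ ≤ r := by
  rw [lintegral_enorm_sq, ENNReal.ofReal_le_ofReal_iff (sq_nonneg r)] at h
  exact abs_le_of_sq_le_sq' h hr |>.2

/-- The Riesz–Fischer argument: a rapidly Cauchy sequence of classes has representatives converging
almost everywhere, and Fatou's lemma turns this into convergence in norm. -/
instance [∀ ω, CompleteSpace (H ω)] : CompleteSpace (G.DirectIntegral μ) := by
  refine Metric.complete_of_convergent_controlled_sequences (fun n => (1 / 2 : ℝ) ^ n)
    (fun n => by positivity) fun x hx => ?_
  choose u hu using fun n => mk_surjective (x n)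
  obtain rfl : (fun n => mk (u n)) = x := funext hu
  have hd : ∀ N n m, N ≤ n → N ≤ m → ‖(mk (u n) : G.DirectIntegral μ) - mk (u m)‖ ≤ (1 / 2) ^ N :=
    fun N n m hn hm => by
      rw [← dist_eq_norm]
      exact (hx N n m hn hm).le
  have hae := ae_cauchySeq fun n => hd n (n + 1) n (Nat.le_succ n) le_rfl
  obtain ⟨t, htsub, htm, ht0⟩ := exists_measurable_superset_of_null (ae_iff.1 hae)
  have hC : ∀ ω, ω ∉ t → CauchySeq fun n => (u n).1 ω := fun ω hω => by
    by_contra hcon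
    exact hω (htsub hcon)
  -- Measurability of a limit section is available for limits at every `ω`, so the sequence is set
  -- to 0 on a measurable null set containing the bad points.
  have hex : ∀ ω, ∃ y : H ω, Tendsto (fun n => glue t 0 (u n).1 ω) atTop (𝓝 y) := by
    intro ω
    by_cases hω : ω ∈ t
    · exact ⟨0, by simp [glue_of_mem hω]⟩
    · simp only [glue_of_notMem hω]
      exact cauchySeq_tendsto_of_complete (hC ω hω)
  choose s hs using hex
  have hsec : s ∈ G.sections := mem_sections_of_tendsto
    (fun n => glue_mem_sections htm G.sections.zero_mem (u n).2.1) hs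
  have htend : ∀ᵐ ω ∂μ, Tendsto (fun n => (u n).1 ω) atTop (𝓝 (s ω)) := by
    filter_upwards [compl_mem_ae_iff.2 ht0] with ω hω
    have := hs ω
    simpa only [glue_of_notMem hω] using this
  have hbound : ∀ N, ∫⁻ ω, ‖s ω - (u N).1 ω‖ₑ ^ 2 ∂μ ≤ ENNReal.ofReal (((1 / 2) ^ N) ^ 2) := by
    intro N
    calc ∫⁻ ω, ‖s ω - (u N).1 ω‖ₑ ^ 2 ∂μ
        = ∫⁻ ω, liminf (fun n => ‖(u n - u N).1 ω‖ₑ ^ 2) atTop ∂μ := by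
          refine lintegral_congr_ae ?_
          filter_upwards [htend] with ω hω
          refine (Tendsto.liminf_eq ?_).symm
          exact ((ENNReal.continuous_pow 2).tendsto _).comp (hω.sub_const _).enorm
      _ ≤ liminf (fun n => ∫⁻ ω, ‖(u n - u N).1 ω‖ₑ ^ 2 ∂μ) atTop :=
          lintegral_liminf_le fun n => measurable_enorm_sq (u n - u N).2.1
      _ ≤ ENNReal.ofReal (((1 / 2) ^ N) ^ 2) := by
          refine liminf_le_of_frequently_le' (Eventually.frequently ?_)
          filter_upwards [eventually_ge_atTop N] with n hn
          rw [lintegral_enorm_sq, map_sub]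
          refine ENNReal.ofReal_le_ofReal ?_
          gcongr
          exact hd N n N hn le_rfl
  have hsq0 : s - (u 0).1 ∈ G.sqIntegrable μ :=
    ⟨G.sections.sub_mem hsec (u 0).2.1, (hbound 0).trans_lt ENNReal.ofReal_lt_top⟩
  have hsq : s ∈ G.sqIntegrable μ := by
    have := (G.sqIntegrable μ).add_mem hsq0 (u 0).2
    rwa [sub_add_cancel] at this
  refine ⟨mk ⟨s, hsq⟩, ?_⟩
  rw [tendsto_iff_norm_sub_tendsto_zero]
  refine squeeze_zero (fun n => norm_nonneg _) (fun n => ?_)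
    (tendsto_pow_atTop_nhds_zero_of_lt_one (r := (1 / 2 : ℝ)) (by norm_num) (by norm_num))
  rw [norm_sub_rev, ← map_sub]
  exact norm_mk_le_of_lintegral_le (by positivity) (hbound n)

end DirectIntegral

theorem ratCombination_mem {e : ℕ → ∀ ω, H ω} (he : ∀ n, e n ∈ G.sections)
    (l : List (ℚ × ℕ)) : ratCombination e l ∈ G.sections := by
  refine list_sum_mem fun x hx => ?_
  obtain ⟨c, -, rfl⟩ := List.mem_map.1 hx
  exact G.sections.smul_mem _ (he _)

/-- There is a countable family of square-integrable sections with pointwise dense values. -/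
theorem exists_denseRange_sqIntegrable (G : MeasurableVectorField H) (μ : Measure Ω)
    [SigmaFinite μ] :
    ∃ x : List (ℚ × ℕ) × ℕ → G.sqIntegrable μ, ∀ ω, DenseRange fun k => (x k).1 ω := by
  obtain ⟨e, he, htot⟩ := G.exists_total
  -- Cutting off to a set of finite measure where the norm is at most `k.2` makes the combination
  -- square-integrable; at a given `ω` nothing is cut once `k.2` is large.
  set s : List (ℚ × ℕ) × ℕ → Set Ω := fun k =>
    spanningSets μ k.2 ∩ {ω | ‖ratCombination e k.1 ω‖ ≤ k.2} with hs
  have hsm : ∀ k, MeasurableSet (s k) := fun k =>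
    (measurableSet_spanningSets μ k.2).inter
      (measurableSet_le (G.measurable_norm _ (ratCombination_mem he k.1)) measurable_const)
  have hmem : ∀ k, glue (s k) (ratCombination e k.1) 0 ∈ G.sqIntegrable μ := by
    intro k
    refine ⟨glue_mem_sections (hsm k) (ratCombination_mem he k.1) G.sections.zero_mem, ?_⟩
    calc ∫⁻ ω, ‖glue (s k) (ratCombination e k.1) 0 ω‖ₑ ^ 2 ∂μ
        ≤ ∫⁻ ω, (spanningSets μ k.2).indicator (fun _ => (k.2 : ℝ≥0∞) ^ 2) ω ∂μ := by
          refine lintegral_mono fun ω => ?_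
          by_cases h : ω ∈ s k
          · dsimp only
            rw [glue_of_mem h, Set.indicator_of_mem h.1]
            gcongr
            have := ENNReal.ofReal_le_ofReal h.2
            simpa only [ofReal_norm, ENNReal.ofReal_natCast] using this
          · simp [glue_of_notMem h]
      _ = (k.2 : ℝ≥0∞) ^ 2 * μ (spanningSets μ k.2) :=
          lintegral_indicator_const (measurableSet_spanningSets μ k.2) _
      _ < ∞ := ENNReal.mul_lt_top (by simp) (measure_spanningSets_lt_top μ k.2)
  refine ⟨fun k => ⟨_, hmem k⟩, fun ω => (denseRange_ratCombination (htot ω)).mono ?_⟩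
  rintro _ ⟨l, rfl⟩
  obtain ⟨i, hi⟩ := Set.mem_iUnion.1 ((iUnion_spanningSets μ).symm ▸ Set.mem_univ ω)
  obtain ⟨j, hj⟩ := exists_nat_ge ‖ratCombination e l ω‖
  refine ⟨(l, max i j), glue_of_mem ⟨monotone_spanningSets μ (le_max_left i j) hi, ?_⟩⟩
  exact hj.trans (by exact_mod_cast le_max_right i j)

end MeasurableVectorField

end DirectIntegralSpace

/-! ### From the graph of the direct integral to the graphs in the fibres. -/

section DirectIntegralOperators

open Filter Topology

variable {Ω : Type*} [MeasurableSpace Ω] {H : Ω → Type*}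
  [∀ ω, NormedAddCommGroup (H ω)] [∀ ω, InnerProductSpace ℝ (H ω)]

namespace MeasurableVectorField

variable {G : MeasurableVectorField H} {μ : Measure Ω}

/-- The value at `ω` of a pair of sections. -/
def evalPair (ω : Ω) (p : G.sqIntegrable μ × G.sqIntegrable μ) : H ω × H ω := (p.1.1 ω, p.2.1 ω)

/-- The pair of classes of a pair of sections. -/
def mkPair (p : G.sqIntegrable μ × G.sqIntegrable μ) : G.DirectIntegral μ × G.DirectIntegral μ :=
  (DirectIntegral.mk p.1, DirectIntegral.mk p.2)

theorem measurable_chainSum (a : G.sqIntegrable μ × G.sqIntegrable μ)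
    (l : List (G.sqIntegrable μ × G.sqIntegrable μ)) (x : G.sqIntegrable μ) :
    Measurable fun ω => chainSum (evalPair ω a) (l.map (evalPair ω)) (x.1 ω) := by
  induction l generalizing x with
  | nil => exact DirectIntegral.measurable_inner (x - a.1).2.1 a.2.2.1
  | cons p l ih =>
    exact (ih p.1).add (DirectIntegral.measurable_inner (x - p.1).2.1 p.2.2.1)

theorem integrable_chainSum (a : G.sqIntegrable μ × G.sqIntegrable μ)
    (l : List (G.sqIntegrable μ × G.sqIntegrable μ)) (x : G.sqIntegrable μ) :
    Integrable (fun ω => chainSum (evalPair ω a) (l.map (evalPair ω)) (x.1 ω)) μ := by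
  induction l generalizing x with
  | nil => exact DirectIntegral.integrable_inner (x - a.1) a.2
  | cons p l ih => exact (ih p.1).add (DirectIntegral.integrable_inner (x - p.1) p.2)

theorem chainSum_mkPair (a : G.sqIntegrable μ × G.sqIntegrable μ)
    (l : List (G.sqIntegrable μ × G.sqIntegrable μ)) (x : G.sqIntegrable μ) :
    chainSum (mkPair a) (l.map mkPair) (DirectIntegral.mk x) =
      ∫ ω, chainSum (evalPair ω a) (l.map (evalPair ω)) (x.1 ω) ∂μ := by
  have hinner : ∀ (x : G.sqIntegrable μ) (p : G.sqIntegrable μ × G.sqIntegrable μ),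
      (inner ℝ (DirectIntegral.mk x - (mkPair p).1) (mkPair p).2 : ℝ) =
        ∫ ω, inner ℝ ((x - p.1).1 ω) (p.2.1 ω) ∂μ := by
    intro x p
    rw [mkPair, ← map_sub, DirectIntegral.inner_mk]
  induction l generalizing x with
  | nil => exact hinner x a
  | cons p l ih =>
    have h := integral_add (integrable_chainSum a l p.1)
      (DirectIntegral.integrable_inner (x - p.1) p.2)
    rw [← ih p.1, ← hinner x p] at h
    exact h.symm

/-- Cyclic monotonicity of the direct integral of operators is inherited almost everywhere by the
values of a countable family of elements of its graph. -/
theorem ae_cyclicallyMonotone {κ : Type*} [Countable κ] {A : ∀ ω, H ω → Set (H ω)}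
    (hc : CyclicallyMonotone {p : G.DirectIntegral μ × G.DirectIntegral μ |
      p.2 ∈ G.directIntegralOp μ A p.1})
    {P : κ → G.sqIntegrable μ × G.sqIntegrable μ}
    (hP : ∀ k, ∀ᵐ ω ∂μ, (P k).2.1 ω ∈ A ω ((P k).1.1 ω)) :
    ∀ᵐ ω ∂μ, CyclicallyMonotone (Set.range fun k => evalPair ω (P k)) := by
  have key : ∀ (k : κ) (l : List κ), ∀ᵐ ω ∂μ,
      chainSum (evalPair ω (P k)) ((l.map P).map (evalPair ω)) ((P k).1.1 ω) ≤ 0 := by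
    intro k l
    set c : Ω → ℝ := fun ω =>
      chainSum (evalPair ω (P k)) ((l.map P).map (evalPair ω)) ((P k).1.1 ω) with hcdef
    set s : Set Ω := {ω | 0 < c ω} with hs
    have hsm : MeasurableSet s :=
      measurableSet_lt measurable_const (measurable_chainSum (P k) (l.map P) (P k).1)
    -- Off `s` all pairs equal `P k`, so the cyclic sum vanishes there; on `s` it is unchanged and
    -- positive. Its integral, nonpositive by cyclic monotonicity, is thus that of `c` over `s`.
    let Q : κ → G.sqIntegrable μ × G.sqIntegrable μ := fun j =>
      (⟨_, glue_mem_sqIntegrable hsm (P j).1.2 (P k).1.2⟩,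
        ⟨_, glue_mem_sqIntegrable hsm (P j).2.2 (P k).2.2⟩)
    have hQin : ∀ j, ∀ ω ∈ s, evalPair ω (Q j) = evalPair ω (P j) := fun j ω hω =>
      Prod.ext (glue_of_mem hω) (glue_of_mem hω)
    have hQout : ∀ j, ∀ ω ∉ s, evalPair ω (Q j) = evalPair ω (P k) := fun j ω hω =>
      Prod.ext (glue_of_notMem hω) (glue_of_notMem hω)
    have hQgraph : ∀ j, mkPair (Q j) ∈ {p : G.DirectIntegral μ × G.DirectIntegral μ |
        p.2 ∈ G.directIntegralOp μ A p.1} := by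
      intro j
      refine (mk_mem_directIntegralOp_iff G μ A _ _).2 ?_
      filter_upwards [hP j, hP k] with ω hj hk
      change (evalPair ω (Q j)).2 ∈ A ω (evalPair ω (Q j)).1
      by_cases hω : ω ∈ s
      · rw [hQin j ω hω]
        exact hj
      · rw [hQout j ω hω]
        exact hk
    have hle := hc _ (hQgraph k) ((l.map Q).map mkPair) (by
      intro p hp
      obtain ⟨q, hq, rfl⟩ := List.mem_map.1 hp
      obtain ⟨j, -, rfl⟩ := List.mem_map.1 hq
      exact hQgraph j)
    have hval : ∀ ω, chainSum (evalPair ω (Q k)) ((l.map Q).map (evalPair ω)) ((Q k).1.1 ω) =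
        s.indicator c ω := by
      intro ω
      change chainSum _ _ (evalPair ω (Q k)).1 = _
      rw [List.map_map]
      by_cases hω : ω ∈ s
      · rw [Set.indicator_of_mem hω, hQin k ω hω]
        simp only [hcdef, List.map_map]
        congr 1
        exact List.map_congr_left fun j _ => hQin j ω hω
      · rw [Set.indicator_of_notMem hω]
        refine chainSum_of_fst_eq fun p hp => ?_
        obtain ⟨j, -, rfl⟩ := List.mem_map.1 hp
        rw [Function.comp_apply, hQout j ω hω, hQout k ω hω]
    have hint : ∫ ω, s.indicator c ω ∂μ ≤ 0 := by
      have h := chainSum_mkPair (Q k) (l.map Q) (Q k).1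
      simp only [hval] at h
      rw [← h]
      exact hle
    have hnonneg : 0 ≤ s.indicator c := Set.indicator_nonneg fun ω hω => le_of_lt hω
    have hzero := (integral_eq_zero_iff_of_nonneg hnonneg
      ((integrable_chainSum (P k) (l.map P) (P k).1).indicator hsm)).1
      (le_antisymm hint (integral_nonneg hnonneg))
    filter_upwards [hzero] with ω hω
    by_contra! hcon
    rw [Set.indicator_of_mem (show ω ∈ s from hcon)] at hω
    exact hcon.ne' hω
  filter_upwards [ae_all_iff.2 fun k => ae_all_iff.2 (key k)] with ω hω
  rintro _ ⟨k, rfl⟩ l hl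
  obtain ⟨l', rfl⟩ : ∃ l' : List κ, l'.map (fun k => evalPair ω (P k)) = l := by
    have : l ∈ Set.range (List.map fun k => evalPair ω (P k)) := by
      rw [Set.range_list_map]
      exact hl
    exact this
  have := hω k l'
  rwa [List.map_map] at this

/-- If the resolvent of the direct integral of monotone operators has full domain, then a countable
family of elements of its graph has values that are dense in the graphs almost everywhere. -/
theorem exists_ae_graph_subset_closure [SigmaFinite μ] {A : ∀ ω, H ω → Set (H ω)}
    (hA : ∀ ω, MonotoneOperator (A ω))
    (hres : ∀ x, ∃ z, x - z ∈ G.directIntegralOp μ A z) :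
    ∃ P : List (ℚ × ℕ) × ℕ → G.sqIntegrable μ × G.sqIntegrable μ,
      (∀ k, ∀ᵐ ω ∂μ, (P k).2.1 ω ∈ A ω ((P k).1.1 ω)) ∧
      ∀ᵐ ω ∂μ, {p : H ω × H ω | p.2 ∈ A ω p.1} ⊆
        closure (Set.range fun k => evalPair ω (P k)) := by
  obtain ⟨x, hx⟩ := exists_denseRange_sqIntegrable G μ
  have hz : ∀ k, ∃ z : G.sqIntegrable μ, ∀ᵐ ω ∂μ, (x k - z).1 ω ∈ A ω (z.1 ω) := by
    intro k
    obtain ⟨y, hy⟩ := hres (DirectIntegral.mk (x k))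
    obtain ⟨z, rfl⟩ := DirectIntegral.mk_surjective y
    rw [← map_sub] at hy
    exact ⟨z, (mk_mem_directIntegralOp_iff G μ A _ _).1 hy⟩
  choose z hz using hz
  refine ⟨fun k => (z k, x k - z k), hz, ?_⟩
  filter_upwards [ae_all_iff.2 hz] with ω hω
  exact (hA ω).graph_subset_closure (hx ω) hω

/-- If the direct integral of monotone operators is a normal cone operator with a resolvent of full
domain, then almost every operator is orthogonal to the chords of its domain. -/
theorem ae_inner_nonpos_of_eq_normalConeOp [SigmaFinite μ] {A : ∀ ω, H ω → Set (H ω)}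
    (hA : ∀ ω, MonotoneOperator (A ω)) {C : Set (G.DirectIntegral μ)}
    (hAC : G.directIntegralOp μ A = normalConeOp C)
    (hres : ∀ x, ∃ z, x - z ∈ G.directIntegralOp μ A z) :
    ∀ᵐ ω ∂μ, ∀ x y, ∀ u ∈ A ω x, ∀ v ∈ A ω y, inner ℝ (y - x) u ≤ 0 := by
  obtain ⟨P, hP, hdense⟩ := exists_ae_graph_subset_closure hA hres
  -- The values of `normalConeOp C` are cones; natural multiples suffice and keep the exceptional
  -- sets countable in number.
  have hcone : ∀ k, ∀ n : ℕ, ∀ᵐ ω ∂μ, (n : ℝ) • (P k).2.1 ω ∈ A ω ((P k).1.1 ω) := by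
    intro k n
    have h := (mk_mem_directIntegralOp_iff G μ A (P k).1 (P k).2).2 (hP k)
    refine (mk_mem_directIntegralOp_iff G μ A (P k).1 ((n : ℝ) • (P k).2)).1 ?_
    rw [hAC] at h ⊢
    refine ⟨h.1, fun y hy => ?_⟩
    rw [map_smul, real_inner_smul_right]
    exact mul_nonpos_of_nonneg_of_nonpos n.cast_nonneg (h.2 y hy)
  filter_upwards [hdense, ae_all_iff.2 hP, ae_all_iff.2 fun k => ae_all_iff.2 (hcone k)]
    with ω hω hPω hcω
  have hcount : ∀ i j, inner ℝ ((P j).1.1 ω - (P i).1.1 ω) ((P i).2.1 ω) ≤ 0 := by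
    intro i j
    by_contra! hpos
    -- If `⟪y - x, u⟫ > 0`, this `n` violates `⟪y - x, v - n • u⟫ ≥ 0`, which is monotonicity at
    -- `(y, v)` and `(x, n • u)`.
    obtain ⟨n, hn⟩ := exists_nat_gt
      (inner ℝ ((P j).1.1 ω - (P i).1.1 ω) ((P j).2.1 ω) /
        inner ℝ ((P j).1.1 ω - (P i).1.1 ω) ((P i).2.1 ω))
    rw [div_lt_iff₀ hpos] at hn
    have h := hA ω _ _ _ (hPω j) _ (hcω i n)
    rw [inner_sub_right, real_inner_smul_right] at h
    linarith
  intro x y u hu v hv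
  have hclosed : IsClosed {p : (H ω × H ω) × (H ω × H ω) | inner ℝ (p.2.1 - p.1.1) p.1.2 ≤ 0} :=
    isClosed_le (by fun_prop) continuous_const
  have hsub : closure (Set.range fun k => evalPair ω (P k)) ×ˢ
      closure (Set.range fun k => evalPair ω (P k)) ⊆
      {p : (H ω × H ω) × (H ω × H ω) | inner ℝ (p.2.1 - p.1.1) p.1.2 ≤ 0} := by
    rw [← closure_prod_eq]
    refine closure_minimal ?_ hclosed
    rintro ⟨_, _⟩ ⟨⟨i, rfl⟩, ⟨j, rfl⟩⟩
    exact hcount i j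
  exact hsub (Set.mk_mem_prod (hω (show (x, u) ∈ _ from hu)) (hω (show (y, v) ∈ _ from hv)))

end MeasurableVectorField

end DirectIntegralOperators

end

theorem propositionp {Ω : Type*} [MeasurableSpace Ω] (μ : Measure Ω) [μ.IsComplete]
    [SigmaFinite μ] (H : Ω → Type*) [∀ ω, NormedAddCommGroup (H ω)]
    [∀ ω, InnerProductSpace ℝ (H ω)] [∀ ω, CompleteSpace (H ω)]
    (G : MeasurableVectorField H) (A : ∀ ω, H ω → Set (H ω))
    (hA : ∀ ω, MaximallyMonotone (A ω)) :
    ((∃ f : G.DirectIntegral μ → EReal, GammaZero f ∧ G.directIntegralOp μ A = subdiff f) →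
      ∀ᵐ ω ∂μ, ∃ g : H ω → EReal, GammaZero g ∧ A ω = subdiff g) ∧
    ((∃ C : Set (G.DirectIntegral μ), C.Nonempty ∧ IsClosed C ∧ Convex ℝ C ∧
        G.directIntegralOp μ A = normalConeOp C) →
      ∀ᵐ ω ∂μ, ∃ D : Set (H ω), D.Nonempty ∧ IsClosed D ∧ Convex ℝ D ∧
        A ω = normalConeOp D) := by
  have hmono : ∀ ω, MonotoneOperator (A ω) := fun ω => (hA ω).1
  constructor
  · rintro ⟨f, hf, hAf⟩
    obtain ⟨P, hP, hdense⟩ := MeasurableVectorField.exists_ae_graph_subset_closure (G := G)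
      (μ := μ) hmono (by
        rw [hAf]
        exact hf.exists_sub_mem_subdiff)
    have hc := cyclicallyMonotone_subdiff hf
    rw [← hAf] at hc
    filter_upwards [hdense, MeasurableVectorField.ae_cyclicallyMonotone hc hP] with ω h1 h2
    -- Cyclic monotonicity on the countable dense family extends to the whole graph of `A ω`.
    exact (hA ω).exists_eq_subdiff (h2.of_subset_closure h1)
  · rintro ⟨C, hne, hcl, hcv, hAC⟩
    have h := MeasurableVectorField.ae_inner_nonpos_of_eq_normalConeOp hmono hAC (by
      rw [hAC]
      exact exists_sub_mem_normalConeOp hne hcl hcv)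
    filter_upwards [h] with ω hω
    exact (hA ω).exists_eq_normalConeOp hω
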